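/- Let $1\le p\le q<\infty$ be real and let $z\in\mathbb{C}$, $|z|\le 1$, be such that the two-point inequality $$\left(\frac{|a+zb|^{q}+|a-zb|^{q}}{2}\right)^{1/q}\le\left(\frac{|a+b|^{p}+|a-b|^{p}}{2}\right)^{1/p}\qquad\text{for all } a,b\in\mathbb{C}$$ holds. Let $d\gamma(x)=\frac{1}{\sqrt{2\pi}}e^{-x^{2}/2}\,dx$ be the standard Gaussian measure on $\mathbb{R}$, and let $g(w)=\sum_{\ell=0}^{L}a_\ell w^\ell$ be a polynomial with complex coefficients. Then for every $s\in[0,1]$ all integrals in $$\Phi(s)=\int_{\mathbb{R}}\left(\int_{\mathbb{R}}\left|\int_{\mathbb{R}}\int_{\mathbb{R}} g\big((u+iv)\sqrt{s}+z(x+iy)\sqrt{1-s}\big)\,d\gamma(v)\,d\gamma(y)\right|^{q}d\gamma(x)\right)^{p/q}d\gamma(u)$$ converge absolutely, and $\Phi$ is monotonically increasing on $[0,1]$, that is, $\Phi(s_1)\le\Phi(s_2)$ whenever $0\le s_1\le s_2\le 1$. -/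

import Mathlib

open MeasureTheory ProbabilityTheory

noncomputable section

namespace BecknerJanson

/-- The standard Gaussian measure `dγ(x) = (2π)^{-1/2} exp (-x² / 2) dx` on the real line. -/
abbrev stdGaussian : Measure ℝ := gaussianReal 0 1

/-- The complex two-point inequality
`((|a + z b|^q + |a - z b|^q) / 2)^(1/q) ≤ ((|a + b|^p + |a - b|^p) / 2)^(1/p)`, all `a b : ℂ`. -/
def TwoPointInequality (p q : ℝ) (z : ℂ) : Prop :=
  ∀ a b : ℂ,
    ((‖a + z * b‖ ^ q + ‖a - z * b‖ ^ q) / 2) ^ (1 / q) ≤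
      ((‖a + b‖ ^ p + ‖a - b‖ ^ p) / 2) ^ (1 / p)

/-- The value `g ((u + i v) √s + z (x + i y) √(1 - s))`. -/
def integrand (g : Polynomial ℂ) (z : ℂ) (s u x v y : ℝ) : ℂ :=
  g.eval (((u : ℂ) + Complex.I * (v : ℂ)) * ((√s : ℝ) : ℂ) +
    z * ((x : ℂ) + Complex.I * (y : ℂ)) * ((√(1 - s) : ℝ) : ℂ))

/-- The complex double integral
`∫∫ g ((u + i v) √s + z (x + i y) √(1 - s)) dγ(v) dγ(y)`. -/
def gaussAverage (g : Polynomial ℂ) (z : ℂ) (s u x : ℝ) : ℂ :=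
  ∫ y, (∫ v, integrand g z s u x v y ∂stdGaussian) ∂stdGaussian

/-- The flow
`s ↦ ∫ (∫ |∫∫ g ((u + i v) √s + z (x + i y) √(1 - s)) dγ(v) dγ(y)|^q dγ(x))^(p/q) dγ(u)`. -/
def flow (g : Polynomial ℂ) (p q : ℝ) (z : ℂ) (s : ℝ) : ℝ :=
  ∫ u, (∫ x, ‖gaussAverage g z s u x‖ ^ q ∂stdGaussian) ^ (p / q) ∂stdGaussian

end BecknerJanson

end

/-!
The theorem follows from Gaussian hypercontractivity with a complex parameter and Minkowski's
inequality.

Write `A_c g (w) = ∫ g (w + c y) dγ(y)` (`gaussShift`), again a polynomial in `w`. The complex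
average in the flow is `(A_{iz√(1-s)} A_{i√s} g)(√s u + z √(1-s) x)`. For `s₁ ≤ s₂`, rotation
invariance of `γ` splits the variable `√(1-s₁) x` into independent parts of variances `s₂ - s₁` and
`1 - s₂`. Hypercontractivity in the first part removes its factor `z` and replaces its `L^q` norm by
an `L^p` norm; Minkowski's inequality (`minkowski_rpow`) moves that `L^p` norm outside the remaining
`L^q` norm; there it merges with `√s₁ u` into a Gaussian variable of variance `s₂`. The result is
the flow at `s₂` (`flow_le_flow`).

Hypercontractivity, `‖∑ b_ℓ z^ℓ H_ℓ‖_q ≤ ‖∑ b_ℓ H_ℓ‖_p` in `L^q(γ)` and `L^p(γ)`, is obtained from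
the discrete cube. On `N` signs the two-point inequality tensorizes, again by Minkowski, to
combinations of elementary symmetric polynomials (`signSum_hypercontractive`). These depend only on
the sum `S` of the signs and satisfy a three-term recurrence in the degree; after rescaling they
become polynomials in `S / √N` within `O(1/N)` of the Hermite polynomials. The central limit
theorem, together with exponential moments bounded uniformly in `N`, gives the limit
(`tendsto_lintegral_scaledWalk`, `hermiteSum_hypercontractive`). Finally `∫ (x + i y)^k dγ(y)` is
the Hermite polynomial `H_k(x)`, because integration by parts gives the Hermite recurrence
(`integral_pow_eq_hermite`).
-/

namespace BecknerJanson

open scoped ENNReal NNReal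

/-! ### Minkowski's integral inequality -/

/-- Hölder's inequality applied to `(∫ f) ^ (r - 1) * f`; finiteness allows the division by a power
of the left side. -/
theorem minkowski_of_ne_top {α β : Type*} [MeasurableSpace α] [MeasurableSpace β]
    {μ : Measure α} {ν : Measure β} [SFinite μ] [SFinite ν] {f : α → β → ℝ≥0∞}
    (hf : Measurable (Function.uncurry f)) {r : ℝ} (hr : 1 ≤ r)
    (hfin : ∫⁻ y, (∫⁻ x, f x y ∂μ) ^ r ∂ν ≠ ∞) :
    (∫⁻ y, (∫⁻ x, f x y ∂μ) ^ r ∂ν) ^ (1 / r) ≤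
      ∫⁻ x, (∫⁻ y, f x y ^ r ∂ν) ^ (1 / r) ∂μ := by
  rcases hr.eq_or_lt with rfl | hr1
  · simp only [ENNReal.rpow_one, div_one]
    exact (lintegral_lintegral_swap (f := fun y x => f x y)
      (hf.comp measurable_swap).aemeasurable).le
  have hr0 : 0 < r := by linarith
  have hH : Measurable fun y => ∫⁻ x, f x y ∂μ :=
    Measurable.lintegral_prod_left' (f := Function.uncurry f) hf
  set H : β → ℝ≥0∞ := fun y => ∫⁻ x, f x y ∂μ
  set I := ∫⁻ y, H y ^ r ∂ν with hI
  set R := ∫⁻ x, (∫⁻ y, f x y ^ r ∂ν) ^ (1 / r) ∂μ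
  have hconj : r.HolderConjugate (r.conjExponent) := Real.HolderConjugate.conjExponent hr1
  have hexp : (r - 1) * r.conjExponent = r := hconj.sub_one_mul_conj
  have key : I ≤ R * I ^ (1 / r.conjExponent) := by
    calc I = ∫⁻ y, ∫⁻ x, f x y * H y ^ (r - 1) ∂μ ∂ν := by
          refine lintegral_congr fun y => ?_
          rw [lintegral_mul_const (H y ^ (r - 1))
            (show Measurable fun x => f x y from hf.comp measurable_prodMk_right)]
          conv_lhs => rw [show r = 1 + (r - 1) by ring,
            ENNReal.rpow_add_of_nonneg _ _ zero_le_one (by linarith), ENNReal.rpow_one]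
      _ = ∫⁻ x, ∫⁻ y, f x y * H y ^ (r - 1) ∂ν ∂μ := by
          refine lintegral_lintegral_swap (f := fun y x => f x y * H y ^ (r - 1)) ?_
          exact ((hf.comp measurable_swap).mul
            ((hH.pow_const _).comp measurable_fst)).aemeasurable
      _ ≤ ∫⁻ x, (∫⁻ y, f x y ^ r ∂ν) ^ (1 / r) * I ^ (1 / r.conjExponent) ∂μ := by
          refine lintegral_mono fun x => ?_
          refine (ENNReal.lintegral_mul_le_Lp_mul_Lq ν hconj
            (hf.comp measurable_prodMk_left).aemeasurable
            (hH.pow_const (r - 1)).aemeasurable).trans ?_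
          simp only [← ENNReal.rpow_mul, hexp]
          exact le_rfl
      _ = R * I ^ (1 / r.conjExponent) := by
          rw [lintegral_mul_const]
          exact (Measurable.lintegral_prod_right' (f := fun p : α × β => f p.1 p.2 ^ r)
            (hf.pow_const r)).pow_const _
  rcases eq_or_ne I 0 with h0 | h0
  · rw [h0, ENNReal.zero_rpow_of_pos (by positivity)]
    exact zero_le
  have hsum : 1 / r = 1 + -(1 / r.conjExponent) := by
    have := hconj.inv_add_inv_eq_one
    simp only [one_div]
    linarith
  rw [hsum, ENNReal.rpow_add _ _ h0 hfin, ENNReal.rpow_one, ENNReal.rpow_neg,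
    ← div_eq_mul_inv]
  exact ENNReal.div_le_of_le_mul key

theorem minkowski {α β : Type*} [MeasurableSpace α] [MeasurableSpace β]
    {μ : Measure α} {ν : Measure β} [IsFiniteMeasure μ] [IsFiniteMeasure ν] {f : α → β → ℝ≥0∞}
    (hf : Measurable (Function.uncurry f)) {r : ℝ} (hr : 1 ≤ r) :
    (∫⁻ y, (∫⁻ x, f x y ∂μ) ^ r ∂ν) ^ (1 / r) ≤
      ∫⁻ x, (∫⁻ y, f x y ^ r ∂ν) ^ (1 / r) ∂μ := by
  have hr0 : 0 < r := by linarith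
  -- truncating `f` at height `n` makes the left side finite
  let g : ℕ → α → β → ℝ≥0∞ := fun n x y => min (f x y) n
  have hg : ∀ n, Measurable (Function.uncurry (g n)) := fun n => hf.min measurable_const
  have hmono : ∀ x y, Monotone fun n => g n x y := fun x y m n h =>
    min_le_min le_rfl (by exact_mod_cast h)
  have hsup : ∀ x y, ⨆ n, g n x y = f x y := fun x y => by
    have : Filter.Tendsto (fun n : ℕ => min (f x y) (n : ℝ≥0∞)) Filter.atTop
        (nhds (min (f x y) ∞)) := tendsto_const_nhds.min ENNReal.tendsto_nat_nhds_top
    rw [min_eq_left le_top] at this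
    exact tendsto_nhds_unique (tendsto_atTop_iSup (hmono x y)) this
  have hbound : ∀ n, (∫⁻ y, (∫⁻ x, g n x y ∂μ) ^ r ∂ν) ^ (1 / r) ≤
      ∫⁻ x, (∫⁻ y, f x y ^ r ∂ν) ^ (1 / r) ∂μ := fun n => by
    refine (minkowski_of_ne_top (hg n) hr ?_).trans ?_
    · refine ne_top_of_le_ne_top (b := ∫⁻ _, ((n : ℝ≥0∞) * μ Set.univ) ^ r ∂ν) ?_ ?_
      · rw [lintegral_const]
        exact ENNReal.mul_ne_top (ENNReal.rpow_ne_top_of_nonneg hr0.le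
          (ENNReal.mul_ne_top (ENNReal.natCast_ne_top n) (measure_ne_top _ _)))
          (measure_ne_top _ _)
      · refine lintegral_mono fun y => ENNReal.rpow_le_rpow ?_ hr0.le
        rw [← lintegral_const]
        exact lintegral_mono fun x => min_le_right _ _
    · refine lintegral_mono fun x => ENNReal.rpow_le_rpow ?_ (by positivity)
      exact lintegral_mono fun y => ENNReal.rpow_le_rpow (min_le_left _ _) hr0.le
  have hlim : ∫⁻ y, (∫⁻ x, f x y ∂μ) ^ r ∂ν = ⨆ n, ∫⁻ y, (∫⁻ x, g n x y ∂μ) ^ r ∂ν := by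
    rw [← lintegral_iSup]
    · refine lintegral_congr fun y => ?_
      simp_rw [← hsup]
      rw [lintegral_iSup (f := fun n x => g n x y) (fun n => (hg n).comp measurable_prodMk_right)
        (fun m n h x => hmono x y h)]
      exact (ENNReal.orderIsoRpow r hr0).map_iSup _
    · exact fun n => (Measurable.lintegral_prod_left' (f := Function.uncurry (g n))
        (hg n)).pow_const r
    · exact fun m n h y => ENNReal.rpow_le_rpow (lintegral_mono fun x => hmono x y h) hr0.le
  rw [hlim, show ∀ x : ℝ≥0∞, x ^ (1 / r) = ENNReal.orderIsoRpow (1 / r) (by positivity) x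
    from fun _ => rfl, OrderIso.map_iSup]
  exact iSup_le hbound

/-- Minkowski's integral inequality between mixed `L^p` and `L^q` norms, `p ≤ q`: putting the
larger exponent inside makes the mixed norm larger. -/
theorem minkowski_rpow {α β : Type*} [MeasurableSpace α] [MeasurableSpace β]
    {μ : Measure α} {ν : Measure β} [IsFiniteMeasure μ] [IsFiniteMeasure ν] {f : α → β → ℝ≥0∞}
    (hf : Measurable (Function.uncurry f)) {p q : ℝ} (hp : 0 < p) (hpq : p ≤ q) :
    (∫⁻ y, (∫⁻ x, f x y ^ p ∂μ) ^ (q / p) ∂ν) ^ (p / q) ≤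
      ∫⁻ x, (∫⁻ y, f x y ^ q ∂ν) ^ (p / q) ∂μ := by
  have h := minkowski (μ := μ) (ν := ν) (f := fun x y => f x y ^ p) (hf.pow_const p)
    (r := q / p) ((one_le_div hp).2 hpq)
  have e : p * (q / p) = q := by field_simp
  simpa only [one_div_div, ← ENNReal.rpow_mul, e] using h

/-! ### Hypercontractivity for symmetric functions on the discrete cube -/

/-- The uniform measure on `{1, -1}`. -/
noncomputable def rademacher : Measure ℝ :=
  (2⁻¹ : ℝ≥0∞) • Measure.dirac 1 + (2⁻¹ : ℝ≥0∞) • Measure.dirac (-1)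

instance : IsProbabilityMeasure rademacher :=
  ⟨by simp [rademacher, ENNReal.inv_two_add_inv_two]⟩

theorem lintegral_rademacher (f : ℝ → ℝ≥0∞) :
    ∫⁻ δ, f δ ∂rademacher = (f 1 + f (-1)) / 2 := by
  simp [rademacher, lintegral_add_measure, lintegral_smul_measure, lintegral_dirac,
    ENNReal.div_eq_inv_mul, mul_add]

/-- The law of the sum of `N` independent uniform signs. -/
noncomputable def walk : ℕ → Measure ℝ
  | 0 => Measure.dirac 0
  | N + 1 => walk N ∗ rademacher

instance isProbabilityMeasure_walk : ∀ N, IsProbabilityMeasure (walk N)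
  | 0 => by rw [walk]; infer_instance
  | N + 1 => by
    have := isProbabilityMeasure_walk N
    rw [walk]; infer_instance

/-- `signSymm N ℓ S` is the value of the `ℓ`-th elementary symmetric polynomial at `N` signs with
sum `S`, as a polynomial in `S`: the coefficient of `t ^ ℓ` in
`(1 + t) ^ ((N + S) / 2) * (1 - t) ^ ((N - S) / 2)`. -/
noncomputable def signSymm (N : ℕ) : ℕ → ℝ → ℝ
  | 0, _ => 1
  | 1, S => S
  | ℓ + 2, S => (S * signSymm N (ℓ + 1) S - (N - ℓ) * signSymm N ℓ S) / (ℓ + 2)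

theorem continuous_signSymm (N : ℕ) : ∀ ℓ, Continuous (signSymm N ℓ)
  | 0 => by
    change Continuous fun S => signSymm N 0 S
    simp only [signSymm]
    fun_prop
  | 1 => by
    change Continuous fun S => signSymm N 1 S
    simp only [signSymm]
    fun_prop
  | ℓ + 2 => by
    have h1 := continuous_signSymm N ℓ
    have h2 := continuous_signSymm N (ℓ + 1)
    change Continuous fun S => signSymm N (ℓ + 2) S
    simp only [signSymm]
    fun_prop

theorem signSymm_zero_succ : ∀ ℓ, signSymm 0 (ℓ + 1) 0 = 0
  | 0 => by simp [signSymm]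
  | 1 => by simp [signSymm]
  | ℓ + 2 => by
    rw [signSymm, signSymm_zero_succ ℓ]
    simp

/-- Adjoining one more sign `δ` to `N` signs. -/
theorem signSymm_succ (N : ℕ) (S : ℝ) {δ : ℝ} (hδ : δ ^ 2 = 1) : ∀ ℓ,
    signSymm (N + 1) (ℓ + 1) (S + δ) = signSymm N (ℓ + 1) S + δ * signSymm N ℓ S
  | 0 => by simp [signSymm]
  | 1 => by
    simp only [signSymm]
    push_cast
    linear_combination hδ / 2
  | ℓ + 2 => by
    have h1 := signSymm_succ N S hδ (ℓ + 1)
    have h0 := signSymm_succ N S hδ ℓ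
    rw [signSymm, h1, h0, show signSymm N (ℓ + 2 + 1) S = (S * signSymm N (ℓ + 2) S -
      (N - (ℓ + 1 : ℕ)) * signSymm N (ℓ + 1) S) / ((ℓ + 1 : ℕ) + 2) by rw [signSymm]]
    have e : signSymm N (ℓ + 2) S * (ℓ + 2) =
        S * signSymm N (ℓ + 1) S - (N - ℓ) * signSymm N ℓ S := by
      rw [signSymm]; field_simp
    push_cast
    have : (ℓ : ℝ) + 1 + 2 ≠ 0 := by positivity
    field_simp
    linear_combination signSymm N (ℓ + 1) S * hδ - δ * e

/-- The symmetric multilinear polynomial `∑ c ℓ z ^ ℓ e_ℓ` of `N` signs with sum `S`. -/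
noncomputable def signSum (d : ℕ) (z : ℂ) (c : ℕ → ℂ) (N : ℕ) (S : ℝ) : ℂ :=
  ∑ ℓ ∈ Finset.range d, c ℓ * z ^ ℓ * (signSymm N ℓ S : ℂ)

theorem continuous_signSum (d : ℕ) (z : ℂ) (c : ℕ → ℂ) (N : ℕ) :
    Continuous (signSum d z c N) := by
  have := continuous_signSymm N
  unfold signSum
  fun_prop

theorem signSum_succ {d : ℕ} (z : ℂ) {c : ℕ → ℂ} (hc : ∀ ℓ, d ≤ ℓ → c ℓ = 0) (N : ℕ) (S : ℝ)
    {δ : ℝ} (hδ : δ ^ 2 = 1) :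
    signSum d z c (N + 1) (S + δ) =
      signSum d z c N S + z * δ * signSum d z (fun ℓ => c (ℓ + 1)) N S := by
  cases d with
  | zero => simp [signSum]
  | succ d =>
    unfold signSum
    rw [Finset.sum_range_succ', Finset.sum_range_succ' (fun ℓ => c ℓ * z ^ ℓ * _),
      Finset.sum_range_succ (fun ℓ => c (ℓ + 1) * z ^ ℓ * _), hc (d + 1) le_rfl]
    simp_rw [signSymm_succ N S hδ]
    rw [zero_mul, zero_mul, add_zero, Finset.mul_sum, add_right_comm, ← Finset.sum_add_distrib]
    congr 1
    refine Finset.sum_congr rfl fun ℓ _ => ?_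
    push_cast
    ring

theorem signSum_add_mul (d : ℕ) (z : ℂ) (c c' : ℕ → ℂ) (δ : ℂ) (N : ℕ) (S : ℝ) :
    signSum d z (fun ℓ => c ℓ + δ * c' ℓ) N S = signSum d z c N S + δ * signSum d z c' N S := by
  unfold signSum
  rw [Finset.mul_sum, ← Finset.sum_add_distrib]
  exact Finset.sum_congr rfl fun ℓ _ => by ring

theorem ae_rademacher_sq : ∀ᵐ δ ∂rademacher, δ ^ 2 = 1 := by
  rw [rademacher, ae_add_measure_iff]
  constructor <;> refine Measure.ae_smul_measure ?_ _ <;>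
    rw [ae_dirac_iff (measurableSet_eq_fun (by fun_prop) (by fun_prop))] <;> norm_num

/-- The two-point inequality as hypercontractivity for a single uniform sign. -/
theorem TwoPointInequality.lintegral_rademacher {p q : ℝ} (hp : 0 < p) (hq : 0 < q) {z : ℂ}
    (h : TwoPointInequality p q z) (a b : ℂ) :
    ∫⁻ δ, ‖a + z * (δ : ℝ) * b‖ₑ ^ q ∂rademacher ≤
      (∫⁻ δ, ‖a + (δ : ℝ) * b‖ₑ ^ p ∂rademacher) ^ (q / p) := by
  have key : ∀ (r : ℝ), 0 < r → ∀ x y : ℂ, (‖x‖ₑ ^ r + ‖y‖ₑ ^ r) / 2 =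
      ENNReal.ofReal ((‖x‖ ^ r + ‖y‖ ^ r) / 2) := fun r hr x y => by
    rw [ENNReal.ofReal_div_of_pos two_pos, ENNReal.ofReal_add (by positivity) (by positivity),
      ← ENNReal.ofReal_rpow_of_nonneg (norm_nonneg _) hr.le,
      ← ENNReal.ofReal_rpow_of_nonneg (norm_nonneg _) hr.le, ofReal_norm, ofReal_norm]
    simp
  rw [BecknerJanson.lintegral_rademacher, BecknerJanson.lintegral_rademacher, key q hq, key p hp,
    ENNReal.ofReal_rpow_of_nonneg (by positivity) (by positivity)]
  refine ENNReal.ofReal_le_ofReal ?_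
  have h1 := Real.rpow_le_rpow (by positivity) (h a b) hq.le
  rw [← Real.rpow_mul (by positivity), ← Real.rpow_mul (by positivity), one_div_mul_cancel hq.ne',
    Real.rpow_one, one_div_mul_eq_div] at h1
  simpa [sub_eq_add_neg] using h1

theorem lintegral_walk_succ (N : ℕ) {f : ℝ → ℝ≥0∞} (hf : Measurable f) :
    ∫⁻ S, f S ∂walk (N + 1) = ∫⁻ S, ∫⁻ δ, f (S + δ) ∂rademacher ∂walk N := by
  rw [walk, Measure.lintegral_conv hf]

/-- Tensorization: the two-point inequality passes to symmetric functions of `N` signs. -/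
theorem signSum_hypercontractive {p q : ℝ} (hp : 0 < p) (hpq : p ≤ q) {z : ℂ}
    (h : TwoPointInequality p q z) (d N : ℕ) : ∀ c : ℕ → ℂ, (∀ ℓ, d ≤ ℓ → c ℓ = 0) →
    (∫⁻ S, ‖signSum d z c N S‖ₑ ^ q ∂walk N) ^ (p / q) ≤
      ∫⁻ S, ‖signSum d 1 c N S‖ₑ ^ p ∂walk N := by
  have hq : 0 < q := hp.trans_le hpq
  induction N with
  | zero =>
    intro c _
    have e : ∀ z, signSum d z c 0 0 = signSum d 1 c 0 0 := fun z => by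
      refine Finset.sum_congr rfl fun ℓ _ => ?_
      cases ℓ with
      | zero => simp
      | succ ℓ => simp [signSymm_zero_succ]
    rw [walk, lintegral_dirac, lintegral_dirac, e z, ← ENNReal.rpow_mul, mul_div_cancel₀ _ hq.ne']
  | succ N ih =>
    intro c hc
    have hm : ∀ (z : ℂ) (r : ℝ), Measurable fun S => ‖signSum d z c (N + 1) S‖ₑ ^ r := fun z r =>
      ((continuous_signSum d z c (N + 1)).measurable.enorm).pow_const r
    set c' : ℕ → ℂ := fun ℓ => c (ℓ + 1) with hc'
    have hmA := (continuous_signSum d z c N)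
    have hmB := (continuous_signSum d z c' N)
    calc (∫⁻ S, ‖signSum d z c (N + 1) S‖ₑ ^ q ∂walk (N + 1)) ^ (p / q)
        = (∫⁻ S, ∫⁻ δ, ‖signSum d z c N S + z * (δ : ℝ) * signSum d z c' N S‖ₑ ^ q
            ∂rademacher ∂walk N) ^ (p / q) := by
          rw [lintegral_walk_succ N (hm z q)]
          congr 1
          refine lintegral_congr fun S => lintegral_congr_ae ?_
          filter_upwards [ae_rademacher_sq] with δ hδ
          rw [signSum_succ z hc N S hδ]
      _ ≤ (∫⁻ S, (∫⁻ δ, ‖signSum d z c N S + (δ : ℝ) * signSum d z c' N S‖ₑ ^ p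
            ∂rademacher) ^ (q / p) ∂walk N) ^ (p / q) := by
          refine ENNReal.rpow_le_rpow (lintegral_mono fun S => ?_) (by positivity)
          exact h.lintegral_rademacher hp hq _ _
      _ ≤ ∫⁻ δ, (∫⁻ S, ‖signSum d z c N S + (δ : ℝ) * signSum d z c' N S‖ₑ ^ q
            ∂walk N) ^ (p / q) ∂rademacher := by
          refine minkowski_rpow (f := fun (δ S : ℝ) =>
            ‖signSum d z c N S + (δ : ℝ) * signSum d z c' N S‖ₑ) ?_ hp hpq
          refine Measurable.enorm (Continuous.measurable ?_)
          fun_prop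
      _ ≤ ∫⁻ δ, ∫⁻ S, ‖signSum d 1 c N S + (δ : ℝ) * signSum d 1 c' N S‖ₑ ^ p
            ∂walk N ∂rademacher := by
          refine lintegral_mono fun δ => ?_
          simp_rw [← signSum_add_mul]
          refine ih _ fun ℓ hℓ => ?_
          simp [hc', hc ℓ hℓ, hc (ℓ + 1) (by omega)]
      _ = ∫⁻ S, ‖signSum d 1 c (N + 1) S‖ₑ ^ p ∂walk (N + 1) := by
          have h1 := continuous_signSum d 1 c N
          have h2 := continuous_signSum d 1 c' N
          rw [lintegral_walk_succ N (hm 1 p), lintegral_lintegral_swap]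
          · refine lintegral_congr fun S => lintegral_congr_ae ?_
            filter_upwards [ae_rademacher_sq] with δ hδ
            rw [signSum_succ 1 hc N S hδ, one_mul]
          · refine ((Measurable.enorm (Continuous.measurable ?_)).pow_const p).aemeasurable
            fun_prop

/-! ### The central limit theorem for functions of exponential growth -/

theorem charFun_walk (t : ℝ) : ∀ N, charFun (walk N) t = charFun rademacher t ^ N
  | 0 => by simp [walk, charFun_dirac]
  | N + 1 => by rw [walk, charFun_conv, charFun_walk t N, pow_succ]

/-- The law of `(ε₁ + ⋯ + ε_N) / √N` for independent uniform signs `εᵢ`. -/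
noncomputable def scaledWalk (N : ℕ) : Measure ℝ := (walk N).map fun S => (√N)⁻¹ * S

instance isProbabilityMeasure_scaledWalk (N : ℕ) : IsProbabilityMeasure (scaledWalk N) :=
  Measure.isProbabilityMeasure_map (by fun_prop)

theorem lintegral_scaledWalk (N : ℕ) {f : ℝ → ℝ≥0∞} (hf : Measurable f) :
    ∫⁻ x, f x ∂scaledWalk N = ∫⁻ S, f ((√N)⁻¹ * S) ∂walk N :=
  lintegral_map hf (by fun_prop)

theorem integral_rademacher {E : Type*} [NormedAddCommGroup E] [NormedSpace ℝ E] [CompleteSpace E]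
    (f : ℝ → E) :
    ∫ δ, f δ ∂rademacher = (2⁻¹ : ℝ) • f 1 + (2⁻¹ : ℝ) • f (-1) := by
  have hi : ∀ a : ℝ, Integrable f ((2⁻¹ : ℝ≥0∞) • Measure.dirac a) := fun a =>
    (integrable_dirac (by simp [enorm_lt_top])).smul_measure (by simp)
  rw [rademacher, integral_add_measure (hi _) (hi _), integral_smul_measure, integral_smul_measure,
    integral_dirac, integral_dirac]
  simp

theorem tendsto_scaledWalk :
    Filter.Tendsto (β := ProbabilityMeasure ℝ) (fun N => ⟨scaledWalk N, inferInstance⟩)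
      Filter.atTop (nhds ⟨stdGaussian, inferInstance⟩) := by
  refine ProbabilityMeasure.tendsto_of_tendsto_charFun fun t => ?_
  have h := tendsto_charFun_inv_sqrt_mul_pow (P := rademacher) (X := id) aemeasurable_id
    (by rw [integral_rademacher]; simp) (by rw [integral_rademacher]; norm_num) t
  simp only [Measure.map_id] at h
  simp only [ProbabilityMeasure.coe_mk, charFun_gaussianReal, scaledWalk, charFun_map_mul,
    charFun_walk]
  convert! h using 2
  simp [neg_div]

/-- The moment generating function of the sum of `N` signs. -/
theorem lintegral_exp_walk (b : ℝ) : ∀ N,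
    ∫⁻ S, ENNReal.ofReal (Real.exp (b * S)) ∂walk N = ENNReal.ofReal (Real.cosh b ^ N)
  | 0 => by simp [walk, lintegral_dirac]
  | N + 1 => by
    have h : ∀ S : ℝ, ∫⁻ δ, ENNReal.ofReal (Real.exp (b * (S + δ))) ∂rademacher =
        ENNReal.ofReal (Real.exp (b * S)) * ENNReal.ofReal (Real.cosh b) := fun S => by
      rw [lintegral_rademacher, ← ENNReal.ofReal_add (by positivity) (by positivity),
        ← ENNReal.ofReal_mul (by positivity),
        show (2 : ℝ≥0∞) = ENNReal.ofReal 2 by simp, ← ENNReal.ofReal_div_of_pos two_pos,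
        Real.cosh_eq, mul_add, mul_add, Real.exp_add, Real.exp_add]
      congr 1
      rw [mul_one, mul_neg_one]
      ring
    rw [lintegral_walk_succ N (by fun_prop)]
    simp_rw [h]
    rw [lintegral_mul_const _ (by fun_prop), lintegral_exp_walk b N,
      ← ENNReal.ofReal_mul (by positivity), pow_succ]

theorem lintegral_exp_scaledWalk_le (b : ℝ) (N : ℕ) :
    ∫⁻ x, ENNReal.ofReal (Real.exp (b * x)) ∂scaledWalk N ≤
      ENNReal.ofReal (Real.exp (b ^ 2 / 2)) := by
  rw [lintegral_scaledWalk N (by fun_prop)]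
  simp_rw [← mul_assoc]
  rw [lintegral_exp_walk]
  refine ENNReal.ofReal_le_ofReal ?_
  calc Real.cosh (b * (√N)⁻¹) ^ N ≤ Real.exp ((b * (√N)⁻¹) ^ 2 / 2) ^ N :=
        pow_le_pow_left₀ (Real.cosh_pos _).le (Real.cosh_le_exp_half_sq _) N
    _ = Real.exp (N * ((b * (√N)⁻¹) ^ 2 / 2)) := (Real.exp_nat_mul _ _).symm
    _ ≤ Real.exp (b ^ 2 / 2) := by
      refine Real.exp_le_exp.2 ?_
      rw [mul_pow, inv_pow, Real.sq_sqrt (Nat.cast_nonneg N)]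
      rcases Nat.eq_zero_or_pos N with rfl | hN
      · simp; positivity
      · have : (N : ℝ) ≠ 0 := by positivity
        exact le_of_eq (by field_simp)

/-- A bound for the exponential moments of `scaledWalk N`, uniform in `N`. -/
theorem lintegral_exp_abs_scaledWalk_le (b : ℝ) (N : ℕ) :
    ∫⁻ x, ENNReal.ofReal (Real.exp (b * |x|)) ∂scaledWalk N ≤
      2 * ENNReal.ofReal (Real.exp (b ^ 2 / 2)) := by
  calc ∫⁻ x, ENNReal.ofReal (Real.exp (b * |x|)) ∂scaledWalk N
      ≤ ∫⁻ x, (ENNReal.ofReal (Real.exp (b * x)) + ENNReal.ofReal (Real.exp (-b * x)))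
          ∂scaledWalk N := by
        refine lintegral_mono fun x => ?_
        rcases abs_cases x with ⟨h, _⟩ | ⟨h, _⟩ <;> simp only [h]
        · exact le_self_add
        · rw [mul_neg, neg_mul]
          exact le_add_self
    _ ≤ _ := by
        rw [lintegral_add_left (by fun_prop), two_mul]
        refine add_le_add (lintegral_exp_scaledWalk_le b N) ?_
        simpa using lintegral_exp_scaledWalk_le (-b) N

/-- Weak convergence extends to test functions of exponential growth, since the second moments of
`φ` are bounded uniformly in `N`: `φ ≤ min φ n + φ ^ 2 / n`. -/
theorem tendsto_lintegral_scaledWalk {φ : ℝ → ℝ≥0} (hφ : Continuous φ) (C : ℝ≥0∞) (hC : C ≠ ∞)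
    (a : ℝ) (hb : ∀ x, (φ x : ℝ≥0∞) ≤ C * ENNReal.ofReal (Real.exp (a * |x|))) :
    Filter.Tendsto (fun N => ∫⁻ x, φ x ∂scaledWalk N) Filter.atTop
      (nhds (∫⁻ x, φ x ∂stdGaussian)) := by
  set D : ℝ≥0∞ := C ^ 2 * (2 * ENNReal.ofReal (Real.exp ((2 * a) ^ 2 / 2))) with hD
  have hDtop : D ≠ ∞ := by
    rw [hD]
    exact ENNReal.mul_ne_top (ENNReal.pow_ne_top hC)
      (ENNReal.mul_ne_top (by simp) ENNReal.ofReal_ne_top)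
  have hsq : ∀ N, ∫⁻ x, (φ x : ℝ≥0∞) ^ 2 ∂scaledWalk N ≤ D := fun N => by
    refine (lintegral_mono fun x => pow_le_pow_left' (hb x) 2).trans ?_
    have : ∀ x : ℝ, (C * ENNReal.ofReal (Real.exp (a * |x|))) ^ 2 =
        C ^ 2 * ENNReal.ofReal (Real.exp (2 * a * |x|)) := fun x => by
      rw [mul_pow, ← ENNReal.ofReal_pow (Real.exp_pos _).le, ← Real.exp_nat_mul]
      push_cast
      ring_nf
    simp_rw [this]
    rw [lintegral_const_mul _ (by fun_prop)]
    exact mul_le_mul_right (lintegral_exp_abs_scaledWalk_le _ N) _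
  -- weak convergence applies to the truncations of `φ`
  have htrunc : ∀ n : ℕ, Filter.Tendsto
      (fun N => ∫⁻ x, (min (φ x) (n : ℝ≥0) : ℝ≥0) ∂scaledWalk N) Filter.atTop
      (nhds (∫⁻ x, (min (φ x) (n : ℝ≥0) : ℝ≥0) ∂stdGaussian)) := fun n => by
    have hd : ∀ x y, dist (min (φ x) (n : ℝ≥0)) (min (φ y) (n : ℝ≥0)) ≤ n := fun x y => by
      rw [NNReal.dist_eq, abs_le]
      have h1 : ((min (φ x) (n : ℝ≥0) : ℝ≥0) : ℝ) ≤ n := by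
        exact_mod_cast min_le_right (φ x) (n : ℝ≥0)
      have h2 : ((min (φ y) (n : ℝ≥0) : ℝ≥0) : ℝ) ≤ n := by
        exact_mod_cast min_le_right (φ y) (n : ℝ≥0)
      constructor <;> linarith [NNReal.coe_nonneg (min (φ x) (n : ℝ≥0)),
        NNReal.coe_nonneg (min (φ y) (n : ℝ≥0))]
    exact (ProbabilityMeasure.tendsto_iff_forall_lintegral_tendsto.1 tendsto_scaledWalk)
      (BoundedContinuousFunction.mkOfBound ⟨fun x => min (φ x) n, by fun_prop⟩ n hd)
  have hsup : ∫⁻ x, φ x ∂stdGaussian =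
      ⨆ n : ℕ, ∫⁻ x, (min (φ x) (n : ℝ≥0) : ℝ≥0) ∂stdGaussian := by
    rw [← lintegral_iSup (fun n => by fun_prop) (fun m n h x => by
      simp only [ENNReal.coe_le_coe]
      exact min_le_min le_rfl (by exact_mod_cast h))]
    refine lintegral_congr fun x => le_antisymm ?_ (iSup_le fun n => by
      simp only [ENNReal.coe_le_coe]
      exact min_le_left _ _)
    obtain ⟨n, hn⟩ := exists_nat_ge (φ x)
    exact le_iSup_of_le n (by simp only [min_eq_left hn, le_refl])
  have htail : ∀ n : ℕ, ∀ N, ∫⁻ x, φ x ∂scaledWalk N ≤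
      ∫⁻ x, (min (φ x) (n : ℝ≥0) : ℝ≥0) ∂scaledWalk N + D / n := fun n N => by
    calc ∫⁻ x, φ x ∂scaledWalk N
        ≤ ∫⁻ x, ((min (φ x) (n : ℝ≥0) : ℝ≥0) + (φ x : ℝ≥0∞) ^ 2 * (n : ℝ≥0∞)⁻¹) ∂scaledWalk N := by
          refine lintegral_mono fun x => ?_
          rcases le_total (φ x) n with h | h
          · simp only [min_eq_left h]
            exact le_self_add
          · refine le_trans ?_ le_add_self
            rw [← div_eq_mul_inv]
            have h' : (n : ℝ≥0∞) ≤ φ x := by exact_mod_cast h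
            rcases eq_or_ne (n : ℝ≥0∞) 0 with h0 | h0
            · rcases eq_or_ne (φ x : ℝ≥0∞) 0 with h1 | h1
              · simp [h1]
              · rw [h0, ENNReal.div_zero (by simpa using h1)]
                exact le_top
            · rw [ENNReal.le_div_iff_mul_le (Or.inl h0) (Or.inl (ENNReal.natCast_ne_top n)), sq]
              exact mul_le_mul_right h' _
      _ ≤ _ := by
          rw [lintegral_add_left (by fun_prop), lintegral_mul_const _ (by fun_prop),
            ← div_eq_mul_inv]
          exact add_le_add le_rfl (ENNReal.div_le_div_right (hsq N) _)
  refine tendsto_of_le_liminf_of_limsup_le ?_ ?_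
  · rw [hsup]
    refine iSup_le fun n => ?_
    rw [← (htrunc n).liminf_eq]
    refine Filter.liminf_le_liminf (Filter.Eventually.of_forall fun N =>
      lintegral_mono fun x => ?_)
    simp only [ENNReal.coe_le_coe]
    exact min_le_left _ _
  · have hle : ∀ n : ℕ, Filter.limsup (fun N => ∫⁻ x, φ x ∂scaledWalk N) Filter.atTop ≤
        ∫⁻ x, φ x ∂stdGaussian + D / n := fun n => by
      calc Filter.limsup (fun N => ∫⁻ x, φ x ∂scaledWalk N) Filter.atTop
          ≤ Filter.limsup (fun N => ∫⁻ x, (min (φ x) (n : ℝ≥0) : ℝ≥0) ∂scaledWalk N + D / n)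
              Filter.atTop :=
            Filter.limsup_le_limsup (Filter.Eventually.of_forall (htail n))
        _ = ∫⁻ x, (min (φ x) (n : ℝ≥0) : ℝ≥0) ∂stdGaussian + D / n :=
            ((htrunc n).add tendsto_const_nhds).limsup_eq
        _ ≤ _ := by
            rw [hsup]
            exact add_le_add (le_iSup (fun n : ℕ =>
              ∫⁻ x, (min (φ x) (n : ℝ≥0) : ℝ≥0) ∂stdGaussian) n) le_rfl
    have hlim : Filter.Tendsto (fun n : ℕ => ∫⁻ x, φ x ∂stdGaussian + D / n) Filter.atTop
        (nhds (∫⁻ x, φ x ∂stdGaussian + 0)) := by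
      refine tendsto_const_nhds.add ?_
      have := ENNReal.Tendsto.const_div (a := D) ENNReal.tendsto_nat_nhds_top (Or.inr hDtop)
      simpa using this
    rw [add_zero] at hlim
    exact ge_of_tendsto' hlim hle

/-! ### Hypercontractivity for Hermite sums -/

/-- Deformed Hermite polynomials. At `τ = 0` these are the probabilists' Hermite polynomials,
at `τ = 1 / N` the rescaled elementary symmetric polynomials of `N` signs. -/
noncomputable def deformedHermite (τ : ℝ) : ℕ → ℝ → ℝ
  | 0, _ => 1
  | 1, x => x
  | ℓ + 2, x => x * deformedHermite τ (ℓ + 1) x - (ℓ + 1) * (1 - ℓ * τ) * deformedHermite τ ℓ x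

theorem continuous_deformedHermite (τ : ℝ) : ∀ ℓ, Continuous (deformedHermite τ ℓ)
  | 0 => by
    change Continuous fun x => deformedHermite τ 0 x
    simp only [deformedHermite]
    fun_prop
  | 1 => by
    change Continuous fun x => deformedHermite τ 1 x
    simp only [deformedHermite]
    fun_prop
  | ℓ + 2 => by
    have h1 := continuous_deformedHermite τ ℓ
    have h2 := continuous_deformedHermite τ (ℓ + 1)
    change Continuous fun x => deformedHermite τ (ℓ + 2) x
    simp only [deformedHermite]
    fun_prop

theorem deformedHermite_inv_natCast {N : ℕ} (hN : 0 < N) (S : ℝ) : ∀ ℓ,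
    deformedHermite (N : ℝ)⁻¹ ℓ ((√N)⁻¹ * S) = (ℓ.factorial / √N ^ ℓ) * signSymm N ℓ S
  | 0 => by simp [deformedHermite, signSymm]
  | 1 => by simp [deformedHermite, signSymm]
  | ℓ + 2 => by
    rw [deformedHermite, signSymm, deformedHermite_inv_natCast hN S (ℓ + 1),
      deformedHermite_inv_natCast hN S ℓ]
    have h0 : (0 : ℝ) < √N := Real.sqrt_pos.2 (by exact_mod_cast hN)
    have h1 : (N : ℝ) = √N ^ 2 := (Real.sq_sqrt (Nat.cast_nonneg N)).symm
    rw [show (N : ℝ)⁻¹ = (√N ^ 2)⁻¹ by rw [← h1], show ((N : ℝ) - ℓ) = √N ^ 2 - ℓ by rw [← h1],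
      Nat.factorial_succ (ℓ + 1), Nat.factorial_succ ℓ]
    push_cast
    field_simp
    ring

theorem abs_le_exp_abs (x : ℝ) : |x| ≤ Real.exp |x| := by
  linarith [Real.add_one_le_exp |x|]

theorem exists_deformedHermite_bound : ∀ ℓ : ℕ, ∃ C : ℝ, 0 ≤ C ∧ ∀ τ ∈ Set.Icc (0 : ℝ) 1, ∀ x,
    |deformedHermite τ ℓ x| ≤ C * Real.exp (ℓ * |x|)
  | 0 => ⟨1, zero_le_one, fun τ _ x => by simp [deformedHermite]⟩
  | 1 => ⟨1, zero_le_one, fun τ _ x => by simpa [deformedHermite] using abs_le_exp_abs x⟩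
  | ℓ + 2 => by
    obtain ⟨C₀, h0, hC₀⟩ := exists_deformedHermite_bound ℓ
    obtain ⟨C₁, h1, hC₁⟩ := exists_deformedHermite_bound (ℓ + 1)
    refine ⟨C₁ + (ℓ + 1) * (1 + ℓ) * C₀, by positivity, fun τ hτ x => ?_⟩
    have e1 : Real.exp (((ℓ + 2 : ℕ) : ℝ) * |x|) =
        Real.exp |x| * Real.exp (((ℓ + 1 : ℕ) : ℝ) * |x|) := by
      rw [← Real.exp_add]; push_cast; ring_nf
    have e0 : Real.exp ((ℓ : ℝ) * |x|) ≤ Real.exp (((ℓ + 2 : ℕ) : ℝ) * |x|) := by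
      refine Real.exp_le_exp.2 (mul_le_mul_of_nonneg_right ?_ (abs_nonneg x))
      push_cast; linarith
    have hcoef : |((ℓ : ℝ) + 1) * (1 - ℓ * τ)| ≤ (ℓ + 1) * (1 + ℓ) := by
      rw [abs_mul, abs_of_nonneg (by positivity : (0 : ℝ) ≤ (ℓ : ℝ) + 1)]
      refine mul_le_mul_of_nonneg_left ?_ (by positivity)
      have : (ℓ : ℝ) * τ ≤ ℓ := mul_le_of_le_one_right (by positivity) hτ.2
      have : 0 ≤ (ℓ : ℝ) * τ := mul_nonneg (by positivity) hτ.1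
      rw [abs_le]; constructor <;> linarith
    rw [deformedHermite]
    calc |x * deformedHermite τ (ℓ + 1) x - (ℓ + 1) * (1 - ℓ * τ) * deformedHermite τ ℓ x|
        ≤ |x| * |deformedHermite τ (ℓ + 1) x| +
            |((ℓ : ℝ) + 1) * (1 - ℓ * τ)| * |deformedHermite τ ℓ x| := by
          rw [← abs_mul, ← abs_mul]; exact abs_sub _ _
      _ ≤ Real.exp |x| * (C₁ * Real.exp (((ℓ + 1 : ℕ) : ℝ) * |x|)) +
          ((ℓ + 1) * (1 + ℓ)) * (C₀ * Real.exp (((ℓ + 2 : ℕ) : ℝ) * |x|)) := by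
          gcongr
          · exact abs_le_exp_abs x
          · exact hC₁ τ hτ x
          · exact (hC₀ τ hτ x).trans (mul_le_mul_of_nonneg_left e0 h0)
      _ = _ := by rw [e1]; ring

theorem exists_deformedHermite_sub_bound : ∀ ℓ : ℕ, ∃ C : ℝ, 0 ≤ C ∧ ∀ τ ∈ Set.Icc (0 : ℝ) 1, ∀ x,
    |deformedHermite τ ℓ x - deformedHermite 0 ℓ x| ≤ τ * (C * Real.exp (ℓ * |x|))
  | 0 => ⟨0, le_rfl, fun τ _ x => by simp [deformedHermite]⟩
  | 1 => ⟨0, le_rfl, fun τ _ x => by simp [deformedHermite]⟩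
  | ℓ + 2 => by
    obtain ⟨C₀, h0, hC₀⟩ := exists_deformedHermite_sub_bound ℓ
    obtain ⟨C₁, h1, hC₁⟩ := exists_deformedHermite_sub_bound (ℓ + 1)
    obtain ⟨C, hC0, hC⟩ := exists_deformedHermite_bound ℓ
    refine ⟨C₁ + (ℓ + 1) * C₀ + (ℓ + 1) * ℓ * C, by positivity, fun τ hτ x => ?_⟩
    have e1 : Real.exp (((ℓ + 2 : ℕ) : ℝ) * |x|) =
        Real.exp |x| * Real.exp (((ℓ + 1 : ℕ) : ℝ) * |x|) := by
      rw [← Real.exp_add]; push_cast; ring_nf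
    have e0 : Real.exp ((ℓ : ℝ) * |x|) ≤ Real.exp (((ℓ + 2 : ℕ) : ℝ) * |x|) := by
      refine Real.exp_le_exp.2 (mul_le_mul_of_nonneg_right ?_ (abs_nonneg x))
      push_cast; linarith
    rw [deformedHermite, deformedHermite]
    have hτ0 := hτ.1
    calc |x * deformedHermite τ (ℓ + 1) x - (ℓ + 1) * (1 - ℓ * τ) * deformedHermite τ ℓ x -
          (x * deformedHermite 0 (ℓ + 1) x - (ℓ + 1) * (1 - ℓ * 0) * deformedHermite 0 ℓ x)|
        = |x * (deformedHermite τ (ℓ + 1) x - deformedHermite 0 (ℓ + 1) x) +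
            (-((ℓ : ℝ) + 1) * (deformedHermite τ ℓ x - deformedHermite 0 ℓ x)) +
            ((ℓ : ℝ) + 1) * ℓ * τ * deformedHermite τ ℓ x| := by congr 1; ring
      _ ≤ |x| * |deformedHermite τ (ℓ + 1) x - deformedHermite 0 (ℓ + 1) x| +
            (ℓ + 1) * |deformedHermite τ ℓ x - deformedHermite 0 ℓ x| +
            (ℓ + 1) * ℓ * τ * |deformedHermite τ ℓ x| := by
          refine (abs_add_three _ _ _).trans (le_of_eq ?_)
          rw [abs_mul, abs_mul, abs_mul (((ℓ : ℝ) + 1) * ℓ * τ), abs_neg,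
            abs_of_nonneg (by positivity : (0 : ℝ) ≤ (ℓ : ℝ) + 1),
            abs_of_nonneg (by positivity : (0 : ℝ) ≤ ((ℓ : ℝ) + 1) * ℓ * τ)]
      _ ≤ Real.exp |x| * (τ * (C₁ * Real.exp (((ℓ + 1 : ℕ) : ℝ) * |x|))) +
            (ℓ + 1) * (τ * (C₀ * Real.exp (((ℓ + 2 : ℕ) : ℝ) * |x|))) +
            (ℓ + 1) * ℓ * τ * (C * Real.exp (((ℓ + 2 : ℕ) : ℝ) * |x|)) := by
          gcongr
          · exact abs_le_exp_abs x
          · exact hC₁ τ hτ x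
          · exact (hC₀ τ hτ x).trans (by gcongr)
          · exact (hC τ hτ x).trans (by gcongr)
      _ = _ := by rw [e1]; ring

/-- The sum `∑ b ℓ z ^ ℓ H_ℓ(x)` of deformed Hermite polynomials. -/
noncomputable def hermiteSum (d : ℕ) (z : ℂ) (b : ℕ → ℂ) (τ x : ℝ) : ℂ :=
  ∑ ℓ ∈ Finset.range d, b ℓ * z ^ ℓ * (deformedHermite τ ℓ x : ℂ)

theorem continuous_hermiteSum (d : ℕ) (z : ℂ) (b : ℕ → ℂ) (τ : ℝ) :
    Continuous (hermiteSum d z b τ) := by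
  have := continuous_deformedHermite τ
  unfold hermiteSum
  fun_prop

/-- Bounds `|f ℓ x| ≤ t C_ℓ exp (ℓ |x|)` combine to one for a linear combination of the `f ℓ`. -/
theorem norm_sum_mul_le (d : ℕ) (b : ℕ → ℂ) {f : ℕ → ℝ → ℝ} {t : ℝ} (ht : 0 ≤ t) {C : ℕ → ℝ}
    (hC : ∀ ℓ, 0 ≤ C ℓ) (x : ℝ) (h : ∀ ℓ, |f ℓ x| ≤ t * (C ℓ * Real.exp (ℓ * |x|))) :
    ‖∑ ℓ ∈ Finset.range d, b ℓ * (f ℓ x : ℂ)‖ ≤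
      t * ((∑ ℓ ∈ Finset.range d, ‖b ℓ‖ * C ℓ) * Real.exp (d * |x|)) := by
  rw [Finset.sum_mul, Finset.mul_sum]
  refine (norm_sum_le _ _).trans (Finset.sum_le_sum fun ℓ hℓ => ?_)
  rw [norm_mul, Complex.norm_real, Real.norm_eq_abs]
  have e : Real.exp ((ℓ : ℝ) * |x|) ≤ Real.exp (d * |x|) :=
    Real.exp_le_exp.2 (mul_le_mul_of_nonneg_right
      (by exact_mod_cast (Finset.mem_range.1 hℓ).le) (abs_nonneg x))
  calc ‖b ℓ‖ * |f ℓ x| ≤ ‖b ℓ‖ * (t * (C ℓ * Real.exp (d * |x|))) := by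
        gcongr
        exact (h ℓ).trans (by have := hC ℓ; gcongr)
    _ = _ := by ring

theorem exists_hermiteSum_bound (d : ℕ) (z : ℂ) (b : ℕ → ℂ) : ∃ C : ℝ, 0 ≤ C ∧
    ∀ x, ‖hermiteSum d z b 0 x‖ ≤ C * Real.exp (d * |x|) := by
  choose C hC0 hC using exists_deformedHermite_bound
  refine ⟨∑ ℓ ∈ Finset.range d, ‖b ℓ * z ^ ℓ‖ * C ℓ,
    Finset.sum_nonneg fun ℓ _ => mul_nonneg (norm_nonneg _) (hC0 ℓ), fun x => ?_⟩
  have := norm_sum_mul_le d (fun ℓ => b ℓ * z ^ ℓ) zero_le_one hC0 (f := deformedHermite 0) x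
    (fun ℓ => by rw [one_mul]; exact hC ℓ 0 (by simp) x)
  rwa [one_mul] at this

theorem exists_hermiteSum_sub_bound (d : ℕ) (z : ℂ) (b : ℕ → ℂ) : ∃ C : ℝ, 0 ≤ C ∧
    ∀ τ ∈ Set.Icc (0 : ℝ) 1, ∀ x,
      ‖hermiteSum d z b τ x - hermiteSum d z b 0 x‖ ≤ τ * (C * Real.exp (d * |x|)) := by
  choose C hC0 hC using exists_deformedHermite_sub_bound
  refine ⟨∑ ℓ ∈ Finset.range d, ‖b ℓ * z ^ ℓ‖ * C ℓ,
    Finset.sum_nonneg fun ℓ _ => mul_nonneg (norm_nonneg _) (hC0 ℓ), fun τ hτ x => ?_⟩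
  have := norm_sum_mul_le d (fun ℓ => b ℓ * z ^ ℓ) hτ.1 hC0
    (f := fun ℓ x => deformedHermite τ ℓ x - deformedHermite 0 ℓ x) x (fun ℓ => hC ℓ τ hτ x)
  rw [hermiteSum, hermiteSum, ← Finset.sum_sub_distrib]
  simpa only [Complex.ofReal_sub, mul_sub] using this

theorem tendsto_eLpNorm'_scaledWalk {F : ℝ → ℂ} (hF : Continuous F) {C a : ℝ} (hC : 0 ≤ C)
    (hb : ∀ x, ‖F x‖ ≤ C * Real.exp (a * |x|)) {r : ℝ} (hr : 0 < r) :
    Filter.Tendsto (fun N => eLpNorm' F r (scaledWalk N)) Filter.atTop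
      (nhds (eLpNorm' F r stdGaussian)) := by
  have h := tendsto_lintegral_scaledWalk (φ := fun x => ‖F x‖₊ ^ r)
    ((NNReal.continuous_rpow_const hr.le).comp hF.nnnorm) (ENNReal.ofReal (C ^ r))
    ENNReal.ofReal_ne_top (r * a) fun x => by
      rw [← ENNReal.ofReal_mul (by positivity), ENNReal.coe_rpow_of_nonneg _ hr.le,
        ← enorm_eq_nnnorm, ← ofReal_norm, ENNReal.ofReal_rpow_of_nonneg (norm_nonneg _) hr.le]
      refine ENNReal.ofReal_le_ofReal ((Real.rpow_le_rpow (norm_nonneg _) (hb x) hr.le).trans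
        (le_of_eq ?_))
      rw [Real.mul_rpow hC (Real.exp_pos _).le, ← Real.exp_mul]
      ring_nf
  have h' := (ENNReal.continuous_rpow_const (y := 1 / r)).continuousAt.tendsto.comp h
  simpa only [eLpNorm', Function.comp_def, ENNReal.coe_rpow_of_nonneg _ hr.le,
    ← enorm_eq_nnnorm] using h'

theorem eLpNorm'_scaledWalk_le {F : ℝ → ℂ} {t C a : ℝ} (ht : 0 ≤ t) (hC : 0 ≤ C)
    (hb : ∀ x, ‖F x‖ ≤ t * (C * Real.exp (a * |x|))) {r : ℝ} (hr : 0 < r) (N : ℕ) :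
    eLpNorm' F r (scaledWalk N) ≤ ENNReal.ofReal t *
      (ENNReal.ofReal C * (2 * ENNReal.ofReal (Real.exp ((r * a) ^ 2 / 2))) ^ (1 / r)) := by
  have h : ∀ x, ‖F x‖ₑ ^ r ≤ (ENNReal.ofReal t * ENNReal.ofReal C) ^ r *
      ENNReal.ofReal (Real.exp (r * a * |x|)) := fun x => by
    rw [show r * a * |x| = (a * |x|) * r by ring, Real.exp_mul,
      ← ENNReal.ofReal_rpow_of_nonneg (Real.exp_pos _).le hr.le,
      ← ENNReal.mul_rpow_of_nonneg _ _ hr.le, ← ENNReal.ofReal_mul ht,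
      ← ENNReal.ofReal_mul (by positivity), ← ofReal_norm]
    refine ENNReal.rpow_le_rpow (ENNReal.ofReal_le_ofReal ?_) hr.le
    rw [mul_assoc]
    exact hb x
  rw [eLpNorm', ← mul_assoc]
  calc (∫⁻ x, ‖F x‖ₑ ^ r ∂scaledWalk N) ^ (1 / r)
      ≤ ((ENNReal.ofReal t * ENNReal.ofReal C) ^ r *
          (2 * ENNReal.ofReal (Real.exp ((r * a) ^ 2 / 2)))) ^ (1 / r) := by
        refine ENNReal.rpow_le_rpow ((lintegral_mono h).trans ?_) (by positivity)
        rw [lintegral_const_mul _ (by fun_prop)]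
        exact mul_le_mul_right (lintegral_exp_abs_scaledWalk_le _ N) _
    _ = _ := by
        rw [ENNReal.mul_rpow_of_nonneg _ _ (by positivity), ← ENNReal.rpow_mul,
          mul_one_div_cancel hr.ne', ENNReal.rpow_one]

/-- The hypercontractive inequality on the cube, written for the law of the normalised sum. -/
theorem hermiteSum_scaledWalk_hypercontractive {p q : ℝ} (hp : 0 < p) (hpq : p ≤ q) {z : ℂ}
    (h : TwoPointInequality p q z) (d : ℕ) (b : ℕ → ℂ) {N : ℕ} (hN : 0 < N) :
    eLpNorm' (hermiteSum d z b (N : ℝ)⁻¹) q (scaledWalk N) ≤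
      eLpNorm' (hermiteSum d 1 b (N : ℝ)⁻¹) p (scaledWalk N) := by
  have hq : 0 < q := hp.trans_le hpq
  let c : ℕ → ℂ := fun ℓ => if ℓ < d then b ℓ * ((ℓ.factorial / √N ^ ℓ : ℝ) : ℂ) else 0
  have e : ∀ (z : ℂ) (S : ℝ), hermiteSum d z b (N : ℝ)⁻¹ ((√N)⁻¹ * S) = signSum d z c N S :=
    fun z S => by
      refine Finset.sum_congr rfl fun ℓ hℓ => ?_
      rw [deformedHermite_inv_natCast hN S ℓ]
      simp only [c, if_pos (Finset.mem_range.1 hℓ)]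
      push_cast
      ring
  have hm : ∀ (z : ℂ) (r : ℝ), Measurable fun x => ‖hermiteSum d z b (N : ℝ)⁻¹ x‖ₑ ^ r :=
    fun z r => ((continuous_hermiteSum d z b _).measurable.enorm).pow_const r
  have key := signSum_hypercontractive hp hpq h d N c fun ℓ hℓ => if_neg (not_lt.2 hℓ)
  rw [eLpNorm', eLpNorm', lintegral_scaledWalk N (hm z q), lintegral_scaledWalk N (hm 1 p)]
  simp_rw [e]
  refine le_trans (le_of_eq ?_) (ENNReal.rpow_le_rpow key (by positivity : 0 ≤ 1 / p))
  rw [← ENNReal.rpow_mul]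
  congr 1
  field_simp

/-- Gaussian hypercontractivity: the multiplier `H_ℓ ↦ z ^ ℓ H_ℓ` is a contraction from `L^p` to
`L^q`. -/
theorem hermiteSum_hypercontractive {p q : ℝ} (hp : 1 ≤ p) (hpq : p ≤ q) {z : ℂ}
    (h : TwoPointInequality p q z) (d : ℕ) (b : ℕ → ℂ) :
    eLpNorm' (hermiteSum d z b 0) q stdGaussian ≤ eLpNorm' (hermiteSum d 1 b 0) p stdGaussian := by
  have hp0 : 0 < p := by linarith
  have hq1 : 1 ≤ q := hp.trans hpq
  have hq0 : 0 < q := by linarith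
  obtain ⟨C₁, h1, hC₁⟩ := exists_hermiteSum_bound d z b
  obtain ⟨C₂, h2, hC₂⟩ := exists_hermiteSum_bound d 1 b
  obtain ⟨C₃, h3, hC₃⟩ := exists_hermiteSum_sub_bound d z b
  obtain ⟨C₄, h4, hC₄⟩ := exists_hermiteSum_sub_bound d 1 b
  set M₃ := ENNReal.ofReal C₃ * (2 * ENNReal.ofReal (Real.exp ((q * d) ^ 2 / 2))) ^ (1 / q)
  set M₄ := ENNReal.ofReal C₄ * (2 * ENNReal.ofReal (Real.exp ((p * d) ^ 2 / 2))) ^ (1 / p)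
  have hM₃ : M₃ ≠ ∞ := ENNReal.mul_ne_top ENNReal.ofReal_ne_top (ENNReal.rpow_ne_top_of_nonneg
    (by positivity) (ENNReal.mul_ne_top (by simp) ENNReal.ofReal_ne_top))
  have hM₄ : M₄ ≠ ∞ := ENNReal.mul_ne_top ENNReal.ofReal_ne_top (ENNReal.rpow_ne_top_of_nonneg
    (by positivity) (ENNReal.mul_ne_top (by simp) ENNReal.ofReal_ne_top))
  have hzero : ∀ M : ℝ≥0∞, M ≠ ∞ → Filter.Tendsto (fun N : ℕ => ENNReal.ofReal (N : ℝ)⁻¹ * M)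
      Filter.atTop (nhds 0) := fun M hM => by
    have := ENNReal.Tendsto.mul_const (b := M)
      (ENNReal.tendsto_ofReal (tendsto_inv_atTop_zero.comp
        (tendsto_natCast_atTop_atTop (R := ℝ)))) (Or.inr hM)
    simpa using this
  have hleft := tendsto_eLpNorm'_scaledWalk (continuous_hermiteSum d z b 0) h1 hC₁ hq0
  have hright := ((tendsto_eLpNorm'_scaledWalk (continuous_hermiteSum d 1 b 0) h2 hC₂ hp0).add
    (hzero M₄ hM₄)).add (hzero M₃ hM₃)
  rw [add_zero, add_zero] at hright
  refine le_of_tendsto_of_tendsto hleft hright ?_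
  filter_upwards [Filter.eventually_gt_atTop 0] with N hN
  have hτ : (N : ℝ)⁻¹ ∈ Set.Icc (0 : ℝ) 1 :=
    ⟨by positivity, inv_le_one_of_one_le₀ (by exact_mod_cast hN)⟩
  have hmeas : ∀ z τ, AEStronglyMeasurable (hermiteSum d z b τ) (scaledWalk N) := fun z τ =>
    (continuous_hermiteSum d z b τ).aestronglyMeasurable
  calc eLpNorm' (hermiteSum d z b 0) q (scaledWalk N)
      = eLpNorm' (hermiteSum d z b (N : ℝ)⁻¹ +
          (hermiteSum d z b 0 - hermiteSum d z b (N : ℝ)⁻¹)) q (scaledWalk N) := by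
        rw [add_sub_cancel]
    _ ≤ eLpNorm' (hermiteSum d z b (N : ℝ)⁻¹) q (scaledWalk N) +
          ENNReal.ofReal (N : ℝ)⁻¹ * M₃ := by
        refine (eLpNorm'_add_le (hmeas _ _) ((hmeas _ _).sub (hmeas _ _)) hq1).trans
          (add_le_add le_rfl (eLpNorm'_scaledWalk_le hτ.1 h3 (fun x => ?_) hq0 N))
        rw [Pi.sub_apply, norm_sub_rev]
        exact hC₃ _ hτ x
    _ ≤ eLpNorm' (hermiteSum d 1 b (N : ℝ)⁻¹) p (scaledWalk N) +
          ENNReal.ofReal (N : ℝ)⁻¹ * M₃ :=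
        add_le_add (hermiteSum_scaledWalk_hypercontractive hp0 hpq h d b hN) le_rfl
    _ = eLpNorm' (hermiteSum d 1 b 0 +
          (hermiteSum d 1 b (N : ℝ)⁻¹ - hermiteSum d 1 b 0)) p (scaledWalk N) +
          ENNReal.ofReal (N : ℝ)⁻¹ * M₃ := by rw [add_sub_cancel]
    _ ≤ eLpNorm' (hermiteSum d 1 b 0) p (scaledWalk N) + ENNReal.ofReal (N : ℝ)⁻¹ * M₄ +
          ENNReal.ofReal (N : ℝ)⁻¹ * M₃ := by
        refine add_le_add ((eLpNorm'_add_le (hmeas _ _) ((hmeas _ _).sub (hmeas _ _)) hp).trans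
          (add_le_add le_rfl (eLpNorm'_scaledWalk_le hτ.1 h4 (fun x => ?_) hp0 N))) le_rfl
        exact hC₄ _ hτ x

/-! ### Gaussian averages of polynomials -/

theorem exists_norm_eval_le (P : Polynomial ℂ) :
    ∃ C : ℝ, 0 ≤ C ∧ ∀ w : ℂ, ‖P.eval w‖ ≤ C * Real.exp ‖w‖ := by
  refine ⟨∑ k ∈ Finset.range (P.natDegree + 1), ‖P.coeff k‖ * k.factorial,
    Finset.sum_nonneg fun k _ => by positivity, fun w => ?_⟩
  rw [Polynomial.eval_eq_sum_range, Finset.sum_mul]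
  refine (norm_sum_le _ _).trans (Finset.sum_le_sum fun k _ => ?_)
  rw [norm_mul, norm_pow, mul_assoc]
  refine mul_le_mul_of_nonneg_left ?_ (norm_nonneg _)
  have := Real.pow_div_factorial_le_exp ‖w‖ (norm_nonneg w) k
  rwa [div_le_iff₀' (by positivity)] at this

theorem integrable_exp_mul_abs_stdGaussian (a : ℝ) :
    Integrable (fun x => Real.exp (a * |x|)) stdGaussian :=
  integrable_exp_mul_abs (X := fun x : ℝ => x) (integrable_exp_mul_gaussianReal a)
    (integrable_exp_mul_gaussianReal (-a))

theorem exp_norm_add_le (w c : ℂ) (y : ℝ) :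
    Real.exp ‖w + c * y‖ ≤ Real.exp ‖w‖ * Real.exp (‖c‖ * |y|) := by
  rw [← Real.exp_add]
  refine Real.exp_le_exp.2 ((norm_add_le _ _).trans_eq ?_)
  rw [norm_mul, Complex.norm_real, Real.norm_eq_abs]

theorem integrable_eval (P : Polynomial ℂ) (w c : ℂ) :
    Integrable (fun y : ℝ => P.eval (w + c * y)) stdGaussian := by
  obtain ⟨C, hC0, hC⟩ := exists_norm_eval_le P
  refine ((integrable_exp_mul_abs_stdGaussian ‖c‖).const_mul (C * Real.exp ‖w‖)).mono'
    (Continuous.aestronglyMeasurable (by fun_prop)) (Filter.Eventually.of_forall fun y => ?_)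
  rw [mul_assoc]
  exact (hC _).trans (mul_le_mul_of_nonneg_left (exp_norm_add_le w c y) hC0)

theorem integrable_eval_prod (P : Polynomial ℂ) (w c c' : ℂ) :
    Integrable (fun t : ℝ × ℝ => P.eval (w + c * t.1 + c' * t.2))
      (stdGaussian.prod stdGaussian) := by
  obtain ⟨C, hC0, hC⟩ := exists_norm_eval_le P
  refine (((integrable_exp_mul_abs_stdGaussian ‖c‖).mul_prod
    (integrable_exp_mul_abs_stdGaussian ‖c'‖)).const_mul (C * Real.exp ‖w‖)).mono'
    (Continuous.aestronglyMeasurable (by fun_prop)) (Filter.Eventually.of_forall fun t => ?_)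
  refine (hC _).trans ?_
  rw [mul_assoc C, ← mul_assoc (Real.exp ‖w‖)]
  refine mul_le_mul_of_nonneg_left ((exp_norm_add_le _ c' t.2).trans ?_) hC0
  exact mul_le_mul_of_nonneg_right (exp_norm_add_le w c t.1) (Real.exp_pos _).le

/-- The polynomial `w ↦ ∫ g (w + c y) dγ(y)`, given by Taylor expansion at `w`. -/
noncomputable def gaussShift (c : ℂ) (g : Polynomial ℂ) : Polynomial ℂ :=
  ∑ k ∈ Finset.range (g.natDegree + 1),
    Polynomial.C (c ^ k * ∫ y : ℝ, (y : ℂ) ^ k ∂stdGaussian) * Polynomial.hasseDeriv k g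

theorem eval_gaussShift (c : ℂ) (g : Polynomial ℂ) (w : ℂ) :
    (gaussShift c g).eval w = ∫ y : ℝ, g.eval (w + c * y) ∂stdGaussian := by
  have h : ∀ y : ℝ, g.eval (w + c * y) = ∑ k ∈ Finset.range (g.natDegree + 1),
      (c ^ k * (Polynomial.hasseDeriv k g).eval w) * (y : ℂ) ^ k := fun y => by
    rw [add_comm, ← Polynomial.taylor_eval, Polynomial.eval_eq_sum_range,
      Polynomial.natDegree_taylor]
    refine Finset.sum_congr rfl fun k _ => ?_
    rw [Polynomial.taylor_coeff, mul_pow]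
    ring
  have hint : ∀ k : ℕ, Integrable (fun y : ℝ => (y : ℂ) ^ k) stdGaussian := fun k => by
    simpa using integrable_eval (Polynomial.X ^ k) 0 1
  simp_rw [h]
  rw [integral_finsetSum _ fun k _ => (hint k).const_mul _, gaussShift,
    Polynomial.eval_finsetSum]
  refine Finset.sum_congr rfl fun k _ => ?_
  rw [integral_const_mul, Polynomial.eval_mul, Polynomial.eval_C]
  ring

theorem gaussShift_comm (c c' : ℂ) (g : Polynomial ℂ) :
    gaussShift c (gaussShift c' g) = gaussShift c' (gaussShift c g) := by
  refine Polynomial.funext fun w => ?_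
  simp only [eval_gaussShift]
  rw [integral_integral_swap (integrable_eval_prod g w c c')]
  simp_rw [add_right_comm]

theorem map_mul_conv_map_mul {α β σ : ℝ} (h : σ ^ 2 = α ^ 2 + β ^ 2) :
    stdGaussian.map (fun x => α * x) ∗ stdGaussian.map (fun x => β * x) =
      stdGaussian.map fun x => σ * x := by
  rw [gaussianReal_map_const_mul, gaussianReal_map_const_mul, gaussianReal_map_const_mul,
    gaussianReal_conv_gaussianReal]
  congr 1
  · simp
  · ext
    simp [h]

/-- Rotation invariance: `α x + β y` and `σ x` have the same law when `σ² = α² + β²`. -/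
theorem lintegral_rotation {α β σ : ℝ} (h : σ ^ 2 = α ^ 2 + β ^ 2) {f : ℝ → ℝ≥0∞}
    (hf : Measurable f) :
    ∫⁻ x, ∫⁻ y, f (α * x + β * y) ∂stdGaussian ∂stdGaussian = ∫⁻ x, f (σ * x) ∂stdGaussian := by
  rw [← lintegral_map (f := f) (g := fun x => σ * x) hf (by fun_prop), ← map_mul_conv_map_mul h,
    Measure.lintegral_conv hf, lintegral_map ?_ (by fun_prop)]
  · refine lintegral_congr fun x => ?_
    rw [lintegral_map (by fun_prop) (by fun_prop)]
  · exact Measurable.lintegral_prod_right' (f := fun p : ℝ × ℝ => f (p.1 + p.2)) (by fun_prop)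

theorem integral_rotation {α β σ : ℝ} (h : σ ^ 2 = α ^ 2 + β ^ 2) {f : ℝ → ℂ}
    (hf : Continuous f) (hi : Integrable (fun x => f (σ * x)) stdGaussian) :
    ∫ x, ∫ y, f (α * x + β * y) ∂stdGaussian ∂stdGaussian = ∫ x, f (σ * x) ∂stdGaussian := by
  have hi' : Integrable f (stdGaussian.map fun x => σ * x) :=
    (integrable_map_measure hf.aestronglyMeasurable (by fun_prop)).2 hi
  rw [← integral_map (f := f) (φ := fun x => σ * x) (by fun_prop) hf.aestronglyMeasurable]
  rw [← map_mul_conv_map_mul h] at hi' ⊢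
  rw [integral_conv hi', integral_map (by fun_prop) ?_]
  · refine integral_congr_ae (Filter.Eventually.of_forall fun x => ?_)
    simp only
    rw [integral_map (by fun_prop) (Continuous.aestronglyMeasurable (by fun_prop))]
  · exact StronglyMeasurable.aestronglyMeasurable
      (StronglyMeasurable.integral_prod_right (f := fun x y : ℝ => f (x + y))
        (Continuous.stronglyMeasurable (by fun_prop)))

theorem gaussShift_gaussShift {α β σ : ℝ} (h : σ ^ 2 = α ^ 2 + β ^ 2) (ζ : ℂ)
    (g : Polynomial ℂ) :
    gaussShift (ζ * α) (gaussShift (ζ * β) g) = gaussShift (ζ * σ) g := by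
  refine Polynomial.funext fun w => ?_
  simp only [eval_gaussShift]
  have h1 := integral_rotation h (f := fun t => g.eval (w + ζ * t)) (by fun_prop)
    (by simpa [mul_assoc] using integrable_eval g w (ζ * σ))
  simp only [Complex.ofReal_add, Complex.ofReal_mul, mul_add, ← mul_assoc, ← add_assoc] at h1
  exact h1

theorem hasDerivAt_gaussianPDFReal (y : ℝ) :
    HasDerivAt (gaussianPDFReal 0 1) (-y * gaussianPDFReal 0 1 y) y := by
  have h : HasDerivAt (fun y : ℝ => -(y - 0) ^ 2 / (2 * ((1 : ℝ≥0) : ℝ))) (-y) y := by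
    have := (((hasDerivAt_id y).sub_const 0).pow 2).neg.div_const (2 * ((1 : ℝ≥0) : ℝ))
    refine this.congr_deriv ?_
    simp
    ring
  refine ((h.exp).const_mul ((√(2 * Real.pi * ((1 : ℝ≥0) : ℝ)))⁻¹)).congr_deriv ?_
  rw [gaussianPDFReal]
  ring

theorem integrable_gaussianPDFReal_smul {f : ℝ → ℂ} (hf : Integrable f stdGaussian) :
    Integrable fun y => gaussianPDFReal 0 1 y • f y := by
  rw [stdGaussian, gaussianReal_of_var_ne_zero 0 one_ne_zero,
    integrable_withDensity_iff_integrable_smul' (measurable_gaussianPDF 0 1)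
      (Filter.Eventually.of_forall fun _ => gaussianPDF_lt_top)] at hf
  simpa only [toReal_gaussianPDF] using hf

theorem integrable_add_I_mul_pow (x : ℝ) (k : ℕ) :
    Integrable (fun y : ℝ => ((x : ℂ) + Complex.I * y) ^ k) stdGaussian := by
  simpa using integrable_eval (Polynomial.X ^ k) x Complex.I

theorem integrable_mul_add_I_mul_pow (x : ℝ) (k : ℕ) :
    Integrable (fun y : ℝ => (y : ℂ) * ((x : ℂ) + Complex.I * y) ^ k) stdGaussian := by
  have h := ((integrable_add_I_mul_pow x (k + 1)).sub
    ((integrable_add_I_mul_pow x k).const_mul (x : ℂ))).const_mul (-Complex.I)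
  refine h.congr (Filter.Eventually.of_forall fun y => ?_)
  simp only [Pi.sub_apply]
  linear_combination -(y : ℂ) * ((x : ℂ) + Complex.I * y) ^ k * Complex.I_sq

/-- Gaussian integration by parts for the powers of `x + i y`. -/
theorem integral_mul_pow (x : ℝ) (k : ℕ) :
    ∫ y : ℝ, (y : ℂ) * ((x : ℂ) + Complex.I * y) ^ (k + 1) ∂stdGaussian =
      (k + 1) * Complex.I * ∫ y : ℝ, ((x : ℂ) + Complex.I * y) ^ k ∂stdGaussian := by
  have hd : Integrable (fun y : ℝ => ((k : ℂ) + 1) * Complex.I * ((x : ℂ) + Complex.I * y) ^ k -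
      (y : ℂ) * ((x : ℂ) + Complex.I * y) ^ (k + 1)) stdGaussian :=
    ((integrable_add_I_mul_pow x k).const_mul _).sub (integrable_mul_add_I_mul_pow x (k + 1))
  have hderiv : ∀ y : ℝ, HasDerivAt
      (fun y : ℝ => gaussianPDFReal 0 1 y • ((x : ℂ) + Complex.I * y) ^ (k + 1))
      (gaussianPDFReal 0 1 y • (((k : ℂ) + 1) * Complex.I * ((x : ℂ) + Complex.I * y) ^ k -
        (y : ℂ) * ((x : ℂ) + Complex.I * y) ^ (k + 1))) y := fun y => by
    have h1 : HasDerivAt (fun y : ℝ => (x : ℂ) + Complex.I * y) Complex.I y := by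
      simpa using ((Complex.ofRealCLM.hasDerivAt (x := y)).const_mul Complex.I).const_add (x : ℂ)
    refine ((hasDerivAt_gaussianPDFReal y).smul (h1.fun_pow (k + 1))).congr_deriv ?_
    simp only [Complex.real_smul]
    push_cast
    ring_nf
  have h0 := integral_eq_zero_of_hasDerivAt_of_integrable hderiv
    (integrable_gaussianPDFReal_smul hd)
    (integrable_gaussianPDFReal_smul (integrable_add_I_mul_pow x (k + 1)))
  rw [← integral_gaussianReal_eq_integral_smul one_ne_zero,
    integral_sub ((integrable_add_I_mul_pow x k).const_mul _)
      (integrable_mul_add_I_mul_pow x (k + 1)), integral_const_mul, sub_eq_zero] at h0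
  exact h0.symm

theorem integral_pow_eq_hermite (x : ℝ) : ∀ k : ℕ,
    ∫ y : ℝ, ((x : ℂ) + Complex.I * y) ^ k ∂stdGaussian = (deformedHermite 0 k x : ℂ)
  | 0 => by simp [deformedHermite]
  | 1 => by
    have h1 : Integrable (fun y : ℝ => Complex.I * (y : ℂ)) stdGaussian := by
      simpa using integrable_eval Polynomial.X 0 Complex.I
    simp only [pow_one, deformedHermite]
    rw [integral_add (integrable_const _) h1, integral_const_mul,
      integral_complex_ofReal (f := fun y : ℝ => y),
      integral_id_gaussianReal]
    simp
  | k + 2 => by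
    have e : ∀ y : ℝ, ((x : ℂ) + Complex.I * y) ^ (k + 2) =
        x * ((x : ℂ) + Complex.I * y) ^ (k + 1) +
          Complex.I * ((y : ℂ) * ((x : ℂ) + Complex.I * y) ^ (k + 1)) := fun y => by ring
    simp_rw [e]
    rw [integral_add ((integrable_add_I_mul_pow x _).const_mul _)
      ((integrable_mul_add_I_mul_pow x (k + 1)).const_mul _), integral_const_mul,
      integral_const_mul, integral_mul_pow, integral_pow_eq_hermite x (k + 1),
      integral_pow_eq_hermite x k, deformedHermite]
    push_cast
    linear_combination ((k : ℂ) + 1) * (deformedHermite 0 k x : ℂ) * Complex.I_sq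

theorem integral_eval_mul (f : Polynomial ℂ) (z : ℂ) (x : ℝ) :
    ∫ y : ℝ, f.eval (z * ((x : ℂ) + Complex.I * y)) ∂stdGaussian =
      hermiteSum (f.natDegree + 1) z f.coeff 0 x := by
  simp_rw [Polynomial.eval_eq_sum_range, mul_pow, ← mul_assoc]
  rw [integral_finsetSum _ fun k _ => (integrable_add_I_mul_pow x k).const_mul _, hermiteSum]
  refine Finset.sum_congr rfl fun k _ => ?_
  rw [integral_const_mul, integral_pow_eq_hermite]

/-- Gaussian hypercontractivity, after an affine change of variable `w ↦ w₀ + β w`. -/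
theorem gaussShift_hypercontractive {p q : ℝ} (hp : 1 ≤ p) (hpq : p ≤ q) {z : ℂ}
    (h : TwoPointInequality p q z) (Q : Polynomial ℂ) (w₀ : ℂ) (β : ℝ) :
    ∫⁻ x : ℝ, ‖(gaussShift (Complex.I * z * β) Q).eval (w₀ + z * (β * x : ℝ))‖ₑ ^ q ∂stdGaussian ≤
      (∫⁻ x : ℝ, ‖(gaussShift (Complex.I * β) Q).eval (w₀ + (β * x : ℝ))‖ₑ ^ p
        ∂stdGaussian) ^ (q / p) := by
  have hp0 : 0 < p := by linarith
  have hq0 : 0 < q := by linarith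
  set f : Polynomial ℂ := Q.comp (Polynomial.C w₀ + Polynomial.C (β : ℂ) * Polynomial.X) with hf
  have e : ∀ (z : ℂ) (x : ℝ), (gaussShift (Complex.I * z * β) Q).eval (w₀ + z * (β * x : ℝ)) =
      hermiteSum (f.natDegree + 1) z f.coeff 0 x := fun z x => by
    rw [← integral_eval_mul, eval_gaussShift]
    refine integral_congr_ae (Filter.Eventually.of_forall fun y => ?_)
    simp only [hf, Polynomial.eval_comp, Polynomial.eval_add, Polynomial.eval_mul,
      Polynomial.eval_C, Polynomial.eval_X]
    push_cast
    congr 1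
    ring
  have key := ENNReal.rpow_le_rpow
    (hermiteSum_hypercontractive hp hpq h (f.natDegree + 1) f.coeff) hq0.le
  simp only [eLpNorm', ← ENNReal.rpow_mul, one_div_mul_cancel hq0.ne', ENNReal.rpow_one,
    one_div_mul_eq_div] at key
  simp_rw [e z]
  refine key.trans (le_of_eq ?_)
  simp_rw [← e 1, mul_one, one_mul]

/-! ### The flow -/

theorem gaussAverage_eq (g : Polynomial ℂ) (z : ℂ) (s u x : ℝ) :
    gaussAverage g z s u x =
      (gaussShift (Complex.I * z * √(1 - s)) (gaussShift (Complex.I * √s) g)).eval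
        ((√s * u : ℝ) + z * (√(1 - s) * x : ℝ)) := by
  simp only [gaussAverage, eval_gaussShift, integrand]
  refine integral_congr_ae (Filter.Eventually.of_forall fun y =>
    integral_congr_ae (Filter.Eventually.of_forall fun v => ?_))
  simp only
  push_cast
  congr 1
  ring

theorem integrable_integrand (g : Polynomial ℂ) (z : ℂ) (s u x : ℝ) :
    Integrable (fun w : ℝ × ℝ => integrand g z s u x w.1 w.2) (stdGaussian.prod stdGaussian) := by
  refine (integrable_eval_prod g ((√s * u : ℝ) + z * (√(1 - s) * x : ℝ)) (Complex.I * √s)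
    (Complex.I * z * √(1 - s))).congr (Filter.Eventually.of_forall fun w => ?_)
  simp only [integrand]
  push_cast
  congr 1
  ring

theorem continuous_gaussAverage (g : Polynomial ℂ) (z : ℂ) (s : ℝ) :
    Continuous fun t : ℝ × ℝ => gaussAverage g z s t.1 t.2 := by
  simp_rw [gaussAverage_eq]
  fun_prop

theorem exists_norm_gaussAverage_rpow_le (g : Polynomial ℂ) (z : ℂ) (s : ℝ) {q : ℝ}
    (hq : 0 < q) : ∃ C a b : ℝ, 0 ≤ C ∧ ∀ u x,
      ‖gaussAverage g z s u x‖ ^ q ≤ C * Real.exp (q * (a * |u|)) * Real.exp (b * |x|) := by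
  obtain ⟨C, hC0, hC⟩ := exists_norm_eval_le
    (gaussShift (Complex.I * z * √(1 - s)) (gaussShift (Complex.I * √s) g))
  refine ⟨C ^ q, √s, q * (‖z‖ * √(1 - s)), by positivity, fun u x => ?_⟩
  rw [gaussAverage_eq]
  calc _ ≤ (C * (Real.exp (√s * |u|) * Real.exp (‖z‖ * √(1 - s) * |x|))) ^ q := by
        refine Real.rpow_le_rpow (norm_nonneg _) ((hC _).trans ?_) hq.le
        refine mul_le_mul_of_nonneg_left ?_ hC0
        rw [← Real.exp_add]
        refine Real.exp_le_exp.2 ((norm_add_le _ _).trans_eq ?_)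
        rw [norm_mul, Complex.norm_real, Complex.norm_real, Real.norm_eq_abs, Real.norm_eq_abs,
          abs_mul, abs_mul, abs_of_nonneg (Real.sqrt_nonneg _), abs_of_nonneg (Real.sqrt_nonneg _),
          mul_assoc]
    _ = _ := by
        rw [Real.mul_rpow hC0 (by positivity), Real.mul_rpow (by positivity) (by positivity),
          ← Real.exp_mul, ← Real.exp_mul]
        ring_nf

theorem integrable_norm_gaussAverage_rpow (g : Polynomial ℂ) (z : ℂ) (s : ℝ) {q : ℝ}
    (hq : 0 < q) (u : ℝ) :
    Integrable (fun x => ‖gaussAverage g z s u x‖ ^ q) stdGaussian := by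
  obtain ⟨C, a, b, hC, h⟩ := exists_norm_gaussAverage_rpow_le g z s hq
  have hc := (continuous_gaussAverage g z s).comp (Continuous.prodMk_right u)
  refine ((integrable_exp_mul_abs_stdGaussian b).const_mul (C * Real.exp (q * (a * |u|)))).mono'
    (hc.norm.rpow_const fun _ => Or.inr hq.le).aestronglyMeasurable
    (Filter.Eventually.of_forall fun x => ?_)
  rw [Real.norm_of_nonneg (by positivity)]
  exact h u x

theorem integrable_integral_rpow (g : Polynomial ℂ) (z : ℂ) (s : ℝ) {p q : ℝ} (hp : 0 < p)
    (hq : 0 < q) :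
    Integrable (fun u => (∫ x, ‖gaussAverage g z s u x‖ ^ q ∂stdGaussian) ^ (p / q))
      stdGaussian := by
  obtain ⟨C, a, b, hC, h⟩ := exists_norm_gaussAverage_rpow_le g z s hq
  set M := ∫ x, Real.exp (b * |x|) ∂stdGaussian with hM
  have hM0 : 0 ≤ M := integral_nonneg fun x => (Real.exp_pos _).le
  refine ((integrable_exp_mul_abs_stdGaussian (p * a)).const_mul ((C * M) ^ (p / q))).mono'
    ?_ (Filter.Eventually.of_forall fun u => ?_)
  · have : StronglyMeasurable fun u => ∫ x, ‖gaussAverage g z s u x‖ ^ q ∂stdGaussian :=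
      StronglyMeasurable.integral_prod_right
        (f := fun u x => ‖gaussAverage g z s u x‖ ^ q)
        ((continuous_gaussAverage g z s).norm.rpow_const fun _ => Or.inr hq.le).stronglyMeasurable
    exact (this.measurable.pow_const _).aestronglyMeasurable
  · have hJ : 0 ≤ ∫ x, ‖gaussAverage g z s u x‖ ^ q ∂stdGaussian :=
      integral_nonneg fun x => by positivity
    rw [Real.norm_of_nonneg (by positivity)]
    calc _ ≤ (C * Real.exp (q * (a * |u|)) * M) ^ (p / q) := by
          refine Real.rpow_le_rpow hJ ?_ (by positivity)
          rw [hM, ← integral_const_mul]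
          exact integral_mono (integrable_norm_gaussAverage_rpow g z s hq u)
            ((integrable_exp_mul_abs_stdGaussian b).const_mul _) (h u)
      _ = _ := by
          rw [mul_right_comm, Real.mul_rpow (by positivity) (by positivity), ← Real.exp_mul]
          congr 2
          field_simp

/-- The flow as an iterated lower Lebesgue integral, where Minkowski's inequality applies without
integrability conditions. -/
theorem ofReal_flow (g : Polynomial ℂ) (z : ℂ) (s : ℝ) {p q : ℝ} (hp : 0 < p) (hq : 0 < q) :
    ENNReal.ofReal (flow g p q z s) =
      ∫⁻ u, (∫⁻ x, ‖gaussAverage g z s u x‖ₑ ^ q ∂stdGaussian) ^ (p / q) ∂stdGaussian := by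
  have hJ : ∀ u, 0 ≤ ∫ x, ‖gaussAverage g z s u x‖ ^ q ∂stdGaussian := fun u =>
    integral_nonneg fun x => by positivity
  rw [flow, ofReal_integral_eq_lintegral_ofReal (integrable_integral_rpow g z s hp hq)
    (Filter.Eventually.of_forall fun u => Real.rpow_nonneg (hJ u) _)]
  refine lintegral_congr fun u => ?_
  rw [← ENNReal.ofReal_rpow_of_nonneg (hJ u) (by positivity),
    ofReal_integral_eq_lintegral_ofReal (integrable_norm_gaussAverage_rpow g z s hq u)
      (Filter.Eventually.of_forall fun x => by positivity)]
  congr 1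
  refine lintegral_congr fun x => ?_
  rw [← ENNReal.ofReal_rpow_of_nonneg (norm_nonneg _) hq.le, ofReal_norm]

/-- Moving variance `s₂ - s₁` from the inner integral to the outer one increases the flow. -/
theorem flow_le_flow {p q : ℝ} (hp : 1 ≤ p) (hpq : p ≤ q) {z : ℂ}
    (h : TwoPointInequality p q z) (g : Polynomial ℂ) {s₁ s₂ : ℝ} (h₁ : 0 ≤ s₁) (h₁₂ : s₁ ≤ s₂)
    (h₂ : s₂ ≤ 1) : flow g p q z s₁ ≤ flow g p q z s₂ := by
  have hp0 : 0 < p := by linarith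
  have hq0 : 0 < q := by linarith
  have hflow : 0 ≤ flow g p q z s₂ :=
    integral_nonneg fun u => Real.rpow_nonneg (integral_nonneg fun x => by positivity) _
  rw [← ENNReal.ofReal_le_ofReal_iff hflow, ofReal_flow g z s₁ hp0 hq0, ofReal_flow g z s₂ hp0 hq0]
  simp_rw [gaussAverage_eq]
  -- the noise of variance `1 - s₁` splits into a part of variance `s₂ - s₁`, to be moved from the
  -- inner to the outer integral, and a part of variance `1 - s₂`, which stays
  set α := √s₁
  set β := √(s₂ - s₁)
  set κ := √(1 - s₂)
  have hα : α ^ 2 = s₁ := Real.sq_sqrt h₁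
  have hβ : β ^ 2 = s₂ - s₁ := Real.sq_sqrt (by linarith)
  have hκ : κ ^ 2 = 1 - s₂ := Real.sq_sqrt (by linarith)
  have hσ : √(1 - s₁) ^ 2 = κ ^ 2 + β ^ 2 := by
    rw [Real.sq_sqrt (by linarith), hκ, hβ]; ring
  have hs₂ : √s₂ ^ 2 = α ^ 2 + β ^ 2 := by
    rw [Real.sq_sqrt (by linarith), hα, hβ]; ring
  set Q := gaussShift (Complex.I * z * κ) (gaussShift (Complex.I * α) g) with hQ
  have hP₁ : gaussShift (Complex.I * z * √(1 - s₁)) (gaussShift (Complex.I * α) g) =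
      gaussShift (Complex.I * z * β) Q := by
    rw [hQ, gaussShift_gaussShift (hσ.trans (add_comm _ _))]
  have hP₂ : gaussShift (Complex.I * z * κ) (gaussShift (Complex.I * √s₂) g) =
      gaussShift (Complex.I * β) Q := by
    rw [hQ, gaussShift_comm (Complex.I * β), gaussShift_gaussShift (hs₂.trans (add_comm _ _))]
  rw [hP₁, hP₂]
  set P₁ := gaussShift (Complex.I * z * β) Q
  set P₂ := gaussShift (Complex.I * β) Q
  have hinner : ∀ u : ℝ,
      (∫⁻ x : ℝ, ‖P₁.eval ((α * u : ℝ) + z * (√(1 - s₁) * x : ℝ))‖ₑ ^ q ∂stdGaussian) ^ (p / q) ≤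
      ∫⁻ x' : ℝ, (∫⁻ x : ℝ, ‖P₂.eval ((α * u + β * x' : ℝ) + z * (κ * x : ℝ))‖ₑ ^ q
        ∂stdGaussian) ^ (p / q) ∂stdGaussian := fun u => by
    have hrot := lintegral_rotation hσ
      (f := fun t => ‖P₁.eval ((α * u : ℝ) + z * (t : ℝ))‖ₑ ^ q)
      (((Continuous.measurable (by fun_prop)).enorm).pow_const q)
    calc _ = (∫⁻ x : ℝ, ∫⁻ x' : ℝ, ‖P₁.eval ((α * u : ℝ) + z * (κ * x + β * x' : ℝ))‖ₑ ^ q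
            ∂stdGaussian ∂stdGaussian) ^ (p / q) := by rw [hrot]
      _ ≤ (∫⁻ x : ℝ, (∫⁻ x' : ℝ, ‖P₂.eval ((α * u + β * x' : ℝ) + z * (κ * x : ℝ))‖ₑ ^ p
            ∂stdGaussian) ^ (q / p) ∂stdGaussian) ^ (p / q) := by
          refine ENNReal.rpow_le_rpow (lintegral_mono fun x => ?_) (by positivity)
          refine le_trans (le_of_eq ?_) ((gaussShift_hypercontractive hp hpq h Q
            ((α * u : ℝ) + z * (κ * x : ℝ)) β).trans (le_of_eq ?_))
          · refine lintegral_congr fun x' => ?_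
            congr 3
            push_cast
            ring
          · congr 1
            refine lintegral_congr fun x' => ?_
            congr 3
            push_cast
            ring
      _ ≤ _ := by
          refine minkowski_rpow (f := fun x' x : ℝ =>
            ‖P₂.eval ((α * u + β * x' : ℝ) + z * (κ * x : ℝ))‖ₑ) ?_ hp0 hpq
          exact Measurable.enorm (Continuous.measurable (by fun_prop))
  refine (lintegral_mono hinner).trans (le_of_eq ?_)
  refine lintegral_rotation hs₂ (f := fun t => (∫⁻ x : ℝ,
    ‖P₂.eval ((t : ℝ) + z * (κ * x : ℝ))‖ₑ ^ q ∂stdGaussian) ^ (p / q)) ?_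
  refine (Measurable.lintegral_prod_right' (f := fun t : ℝ × ℝ =>
    ‖P₂.eval ((t.1 : ℝ) + z * (κ * t.2 : ℝ))‖ₑ ^ q) ?_).pow_const _
  exact ((Continuous.measurable (by fun_prop)).enorm).pow_const q

end BecknerJanson

theorem corollary2p4 (p q : ℝ) (hp : 1 ≤ p) (hpq : p ≤ q) (z : ℂ) (hz : ‖z‖ ≤ 1)
    (h : BecknerJanson.TwoPointInequality p q z) (g : Polynomial ℂ) :
    -- all the integrals that define the flow converge absolutely
    (∀ s ∈ Set.Icc (0 : ℝ) 1,
      (∀ u x : ℝ, Integrable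
        (fun w : ℝ × ℝ => BecknerJanson.integrand g z s u x w.1 w.2)
        (BecknerJanson.stdGaussian.prod BecknerJanson.stdGaussian)) ∧
      (∀ u : ℝ, Integrable
        (fun x : ℝ => ‖BecknerJanson.gaussAverage g z s u x‖ ^ q) BecknerJanson.stdGaussian) ∧
      Integrable
        (fun u : ℝ =>
          (∫ x, ‖BecknerJanson.gaussAverage g z s u x‖ ^ q ∂BecknerJanson.stdGaussian) ^ (p / q))
        BecknerJanson.stdGaussian) ∧
    -- and the flow is increasing on the unit interval
    MonotoneOn (BecknerJanson.flow g p q z) (Set.Icc (0 : ℝ) 1) := by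
  have hp0 : 0 < p := by linarith
  have hq0 : 0 < q := by linarith
  exact ⟨fun s _ => ⟨fun u x => BecknerJanson.integrable_integrand g z s u x,
      fun u => BecknerJanson.integrable_norm_gaussAverage_rpow g z s hq0 u,
      BecknerJanson.integrable_integral_rpow g z s hp0 hq0⟩,
    fun _ h₁ _ h₂ h₁₂ => BecknerJanson.flow_le_flow hp hpq h g h₁.1 h₁₂ h₂.2⟩
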